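/- Let $G_0$ be the graph with two vertices joined by one edge labelled $a$, and let $G_{n+1}$ be obtained from $G_n$ by the replacement rules of the Basilica Schreier graphs: each $b$-edge becomes an $a$-edge with the same endpoints, and each $a$-edge $wz$ (loops $w=z$ included) is replaced by two $b$-edges $wm$, $mz$ through a new vertex $m$ that carries an $a$-loop. The two boundary vertices of $G_n$ are the two original vertices of $G_0$. Let $c_n(\lambda)$ be the characteristic polynomial of the Dirichlet Laplacian of $G_n$, that is, of $L_nf(x)=\sum_y c_{xy}(f(x)-f(y))$ on functions vanishing at the boundary vertices, where $c_{xy}$ is the number of edges joining $x$ and $y$. Let $\gamma_0=1$ and, inductively for $n\ge1$, let $\gamma_n$ be the polynomial that is coprime to $\gamma_k$ for all $k<n$ and such that $c_n=\gamma_n\prod_{k=1}^{n-1}\gamma_k^{s_{n,k}}$ for some integers $s_{n,k}\ge 0$; these conditions determine a unique sequence $(\gamma_n)_{n\ge0}$. For $n\ge1$ let $$\eta_n=\gamma_{n-1}\prod_{0\le 2j\le n-4}\gamma_{n-2j-3}^{2^j}.$$ Then for every $n\ge0$ $$\deg\gamma_n=\frac{2}{\sqrt7}\Bigl(\rho_1^n\cos\bigl(\phi+\tfrac{2\pi}3\bigr)+\rho_2^n\cos\bigl(\phi+\tfrac{4\pi}3\bigr)+\rho_3^n\cos\phi\Bigr),$$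 where $\phi=\frac13\arctan(-3\sqrt3)$ and $$\rho_1=\tfrac13\bigl(1-2\sqrt7\cos\phi\bigr),\quad \rho_2=\tfrac13\bigl(1-2\sqrt7\cos(\phi+\tfrac{2\pi}3)\bigr),\quad \rho_3=\tfrac13\bigl(1+2\sqrt7\cos(\phi+\tfrac{\pi}3)\bigr)$$ are the roots of $\rho^3-\rho^2-2\rho+1$. Moreover $\deg\gamma_0=0$, $\deg\gamma_1=1$, $\deg\gamma_2=2$ and, for $n\ge3$, $$\deg\gamma_n=\deg\gamma_{n-1}+2\deg\gamma_{n-2}-\deg\gamma_{n-3}.$$ Finally, for every $n\ge1$, $\deg\eta_n=\deg\gamma_n-2^{m}$, where $m=\lfloor\frac{n-1}2\rfloor$ is the greatest integer (strictly) less than $\frac n2$. -/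

import Mathlib

open Polynomial

namespace Basilica

/-- A finite multigraph (loops and multiple edges allowed) whose edges carry the label `a` or `b`. -/
structure LGraph where
  V : Type
  A : Type
  B : Type
  [fintypeV : Fintype V]
  [fintypeA : Fintype A]
  [fintypeB : Fintype B]
  [decEqV : DecidableEq V]
  [decEqA : DecidableEq A]
  [decEqB : DecidableEq B]
  /-- endpoints of the edges labelled `a` -/
  endsA : A → V × V
  /-- endpoints of the edges labelled `b` -/
  endsB : B → V × V

attribute [instance] LGraph.fintypeV LGraph.fintypeA LGraph.fintypeB LGraph.decEqV LGraph.decEqA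
  LGraph.decEqB

/-- The replacement rules: old vertices `w` are kept (renamed `0w`) and
every `b`-edge `w z` becomes an `a`-edge `w z`;
every `a`-edge `e = w z` gets a new vertex `m_e`, carrying an `a`-loop, and becomes two `b`-edges
`w m_e` and `m_e z`.
For an `a`-loop at `w` the last rule yields two parallel `b`-edges between `w` and `m_e`,
and an `a`-loop at `m_e`.
The sum `Γ.V ⊕ Γ.A` lists the old vertices and the new ones. -/
def LGraph.replace (Γ : LGraph) : LGraph where
  V := Γ.V ⊕ Γ.A
  A := Γ.B ⊕ Γ.A
  B := Γ.A ⊕ Γ.A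
  decEqV := inferInstance
  decEqB := inferInstance
  decEqA := inferInstance
  endsA := Sum.elim
    (fun e => (Sum.inl (Γ.endsB e).1, Sum.inl (Γ.endsB e).2))
    (fun e => (Sum.inr e, Sum.inr e))
  endsB := Sum.elim
    (fun e => (Sum.inl (Γ.endsA e).1, Sum.inr e))
    (fun e => (Sum.inr e, Sum.inl (Γ.endsA e).2))

/-- The complete graph on two vertices, its only edge being labelled `a`. -/
def G0 : LGraph where
  V := Bool
  A := Unit
  B := Empty
  endsA := fun _ => (false, true)
  endsB := Empty.elim

/-- The graph `G_n`: `n` applications of the replacement rules to `G_0`. -/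
def G : ℕ → LGraph
  | 0 => G0
  | n + 1 => (G n).replace

/-- The two boundary vertices of `G_n`: the original two vertices of `G_0`. -/
def boundaryPt : (n : ℕ) → Bool → (G n).V
  | 0 => fun i => i
  | n + 1 => fun i => Sum.inl (boundaryPt n i)

/-- The interior vertices `G_n \ ∂G_n`. -/
abbrev Interior (n : ℕ) : Type := {x : (G n).V // x ∉ Set.range (boundaryPt n)}

noncomputable instance (n : ℕ) : Fintype (Interior n) := Fintype.ofFinite _

/-- `c_{xy}`: the number of edges joining `x` and `y`. -/
def LGraph.edgeCount (Γ : LGraph) (x y : Γ.V) : ℕ :=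
  (Finset.univ.filter fun e : Γ.A => Γ.endsA e = (x, y) ∨ Γ.endsA e = (y, x)).card +
  (Finset.univ.filter fun e : Γ.B => Γ.endsB e = (x, y) ∨ Γ.endsB e = (y, x)).card

/-- The matrix of the Laplacian `L f(x) = ∑_y c_{xy} (f(x) - f(y))`. -/
def LGraph.laplacian (Γ : LGraph) : Matrix Γ.V Γ.V ℝ :=
  Matrix.diagonal (fun x => ∑ y, (Γ.edgeCount x y : ℝ)) -
    Matrix.of fun x y => (Γ.edgeCount x y : ℝ)

theorem LGraph.laplacian_mulVec (Γ : LGraph) (f : Γ.V → ℝ) (x : Γ.V) :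
    Γ.laplacian.mulVec f x = ∑ y, (Γ.edgeCount x y : ℝ) * (f x - f y) := by
  rw [LGraph.laplacian, Matrix.sub_mulVec, Pi.sub_apply, Matrix.mulVec_diagonal]
  simp only [Matrix.mulVec, dotProduct, Matrix.of_apply, mul_sub, Finset.sum_sub_distrib,
    Finset.sum_mul]

/-- The Dirichlet Laplacian of `G_n`, acting on functions that vanish on `∂G_n`. -/
def dirichletLaplacian (n : ℕ) : Matrix (Interior n) (Interior n) ℝ :=
  (G n).laplacian.submatrix Subtype.val Subtype.val

/-- The characteristic polynomial `c_n` of the Dirichlet Laplacian of `G_n`. -/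
noncomputable def c (n : ℕ) : ℝ[X] := (dirichletLaplacian n).charpoly

/-- `γ` is the sequence of factors of the polynomials `c_n`: `γ_0 = 1` and, for `n ≥ 1`,
`γ_n` is coprime to all `γ_k` with `k < n`, and `c_n = γ_n ∏_{k=1}^{n-1} γ_k ^ s_{n,k}` for some
exponents `s_{n,k}`. -/
def IsFactorSequence (γ : ℕ → ℝ[X]) : Prop :=
  γ 0 = 1 ∧ ∀ n, 1 ≤ n →
    (∀ k, k < n → IsCoprime (γ n) (γ k)) ∧
    ∃ s : ℕ → ℕ, c n = γ n * ∏ k ∈ Finset.Ico 1 n, γ k ^ s k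

/-- `η_n = γ_{n-1} ∏_{0 ≤ 2j ≤ n-4} γ_{n-2j-3} ^ (2^j)`, for `n ≥ 1`. -/
noncomputable def eta (γ : ℕ → ℝ[X]) (n : ℕ) : ℝ[X] :=
  γ (n - 1) * ∏ j ∈ (Finset.range n).filter (fun j => 2 * j + 4 ≤ n), γ (n - 2 * j - 3) ^ 2 ^ j

noncomputable def phi : ℝ := 1 / 3 * Real.arctan (-3 * √3)

noncomputable def rho₁ : ℝ := 1 / 3 * (1 - 2 * √7 * Real.cos phi)

noncomputable def rho₂ : ℝ := 1 / 3 * (1 - 2 * √7 * Real.cos (phi + 2 * Real.pi / 3))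

noncomputable def rho₃ : ℝ := 1 / 3 * (1 + 2 * √7 * Real.cos (phi + Real.pi / 3))

end Basilica

namespace Basilica

/-! The vertices added by a replacement step are pairwise non-adjacent, so a Schur complement
eliminates them all at once. What remains is a matrix of the same kind on the previous graph, with
new edge weights (`LGraph.minor_replace`). Iterating over rational functions gives `c n` as a
product of pivots, `pivot j` occurring once for each `a`-edge of `G (n - 1 - j)`
(`c_eq_prod_pivot`).

The pivots obey a short recursion and have the form `fac (j + 1) / (fac j * den (j + 1))`, where
`den` is a product of earlier `fac k` with indices of one parity. The crux is that the `fac k` are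
polynomials satisfying division-free identities (`fac_identities`) and are pairwise coprime
(`isCoprime_fac`). Collecting exponents gives `c_eq_prod_fac`, so `fac` is a factor sequence; by
monicity and coprimality it is the only one (`IsFactorSequence.unique`).

Each pivot has degree 1 in `X`, because the couplings stay bounded at infinity. Hence
`natDegree_fac_succ`, and eliminating the degrees of `den` leaves a linear recursion with
characteristic polynomial `ρ^3 - ρ^2 - 2ρ + 1`. The closed form then needs only three initial
values, and the degree of `eta` follows by induction in steps of two. -/

/-! ### Laplacians as sums of edge terms -/

/-- The `(x, y)` entry of the symmetric matrix supported on the endpoints of the edge `e`, with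
`p` on the diagonal and `q` off the diagonal; for a loop the entries are added up. -/
def edgeTerm {V R : Type*} [DecidableEq V] [CommRing R] (p q : R) (e : V × V) (x y : V) : R :=
  p * ((if x = e.1 then 1 else 0) * (if y = e.1 then 1 else 0) +
      (if x = e.2 then 1 else 0) * (if y = e.2 then 1 else 0)) +
    q * ((if x = e.1 then 1 else 0) * (if y = e.2 then 1 else 0) +
      (if x = e.2 then 1 else 0) * (if y = e.1 then 1 else 0))

theorem map_edgeTerm {V R S : Type*} [DecidableEq V] [CommRing R] [CommRing S] (f : R →+* S)
    (p q : R) (e : V × V) (x y : V) :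
    f (edgeTerm p q e x y) = edgeTerm (f p) (f q) e x y := by
  simp only [edgeTerm, map_add, map_mul, apply_ite f, map_one, map_zero]

/-- The matrix of a graph with a potential `μ` at every vertex and with the edge terms `(pa, qa)`
for the label `a` and `(pb, qb)` for the label `b`. -/
def LGraph.weighted {R : Type*} [CommRing R] (Γ : LGraph) (μ pa qa pb qb : R) :
    Matrix Γ.V Γ.V R :=
  Matrix.of fun x y => (if x = y then μ else 0) + ∑ e, edgeTerm pa qa (Γ.endsA e) x y +
    ∑ e, edgeTerm pb qb (Γ.endsB e) x y

/-- A loop contributes `-2 + 2 = 0` on the left, and on the right it is counted once in each of the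
two terms, which cancel. -/
theorem sum_edgeTerm_eq {V E : Type*} [Fintype V] [DecidableEq V] [Fintype E]
    (ends : E → V × V) (x y : V) :
    ∑ e, edgeTerm (-1 : ℝ) 1 (ends e) x y =
      ((Finset.univ.filter fun e : E => ends e = (x, y) ∨ ends e = (y, x)).card : ℝ) -
      if x = y then ∑ v, ((Finset.univ.filter fun e : E =>
        ends e = (x, v) ∨ ends e = (v, x)).card : ℝ) else 0 := by
  have hsum : ∀ v, ((Finset.univ.filter fun e : E =>
      ends e = (x, v) ∨ ends e = (v, x)).card : ℝ) =
      ∑ e, if ends e = (x, v) ∨ ends e = (v, x) then (1 : ℝ) else 0 := fun v => by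
    rw [Finset.card_filter]; push_cast; rfl
  simp only [hsum]
  rw [Finset.sum_comm]
  split_ifs with hxy
  · subst hxy
    rw [← Finset.sum_sub_distrib]
    refine Finset.sum_congr rfl fun e _ => ?_
    obtain ⟨w, z⟩ := ends e
    have key : ∑ v, (if (w, z) = (x, v) ∨ (w, z) = (v, x) then (1 : ℝ) else 0) =
        if w = x ∧ z = x then 1 else (if w = x then 1 else 0) + if z = x then 1 else 0 := by
      by_cases hw : w = x <;> by_cases hz : z = x
      · subst hw; subst hz
        simp [Prod.ext_iff]
      · subst hw
        simp [Prod.ext_iff, hz]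
      · subst hz
        simp [Prod.ext_iff, hw]
      · simp [Prod.ext_iff, hz, hw]
    rw [key]
    by_cases hw : w = x <;> by_cases hz : z = x <;>
      simp [edgeTerm, hw, hz, Ne.symm]
  · rw [sub_zero]
    refine Finset.sum_congr rfl fun e _ => ?_
    obtain ⟨w, z⟩ := ends e
    simp only [edgeTerm, Prod.mk.injEq]
    by_cases hw : x = w <;> by_cases hz : x = z <;> by_cases hw' : y = w <;>
      by_cases hz' : y = z <;> grind

theorem LGraph.laplacian_apply (Γ : LGraph) (x y : Γ.V) :
    Γ.laplacian x y = -(∑ e, edgeTerm (-1 : ℝ) 1 (Γ.endsA e) x y +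
      ∑ e, edgeTerm (-1 : ℝ) 1 (Γ.endsB e) x y) := by
  rw [sum_edgeTerm_eq, sum_edgeTerm_eq]
  simp only [LGraph.laplacian, Matrix.sub_apply, Matrix.diagonal_apply, Matrix.of_apply,
    LGraph.edgeCount, Nat.cast_add, Finset.sum_add_distrib]
  split_ifs <;> ring

/-! ### Elimination of the new vertices -/

/-- The determinant of the weighted matrix with the rows and columns in `S` removed. -/
noncomputable def LGraph.minor {R : Type*} [CommRing R] (Γ : LGraph) (S : Set Γ.V)
    (μ pa qa pb qb : R) : R :=
  letI : Fintype {x : Γ.V // x ∉ S} := Fintype.ofFinite _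
  ((Γ.weighted μ pa qa pb qb).submatrix (Subtype.val : {x // x ∉ S} → Γ.V) Subtype.val).det

/-- The vertices outside a set of old vertices, after the replacement. -/
def complEquiv {V A : Type*} (S : Set V) :
    {x : V // x ∉ S} ⊕ A ≃ {x : V ⊕ A // x ∉ Sum.inl '' S} where
  toFun := Sum.elim (fun x => ⟨Sum.inl x.1, by simpa using x.2⟩) (fun e => ⟨Sum.inr e, by simp⟩)
  invFun x := match x with
    | ⟨Sum.inl v, h⟩ => Sum.inl ⟨v, by simpa using h⟩
    | ⟨Sum.inr e, _⟩ => Sum.inr e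
  left_inv := by rintro (x | x) <;> rfl
  right_inv := by rintro ⟨x | x, h⟩ <;> rfl

theorem LGraph.weighted_replace_apply {R : Type*} [CommRing R] (Γ : LGraph) (μ pa qa pb qb : R)
    (x y : Γ.V ⊕ Γ.A) :
    Γ.replace.weighted μ pa qa pb qb x y = (if x = y then μ else 0) +
      ((∑ e, edgeTerm pa qa (Sum.inl (Γ.endsB e).1, Sum.inl (Γ.endsB e).2) x y) +
        ∑ e, edgeTerm pa qa (Sum.inr e, Sum.inr e) x y) +
      ((∑ e, edgeTerm pb qb (Sum.inl (Γ.endsA e).1, Sum.inr e) x y) +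
        ∑ e, edgeTerm pb qb (Sum.inr e, Sum.inl (Γ.endsA e).2) x y) :=
  congrArg₂ (· + ·)
    (congrArg₂ (· + ·) rfl
      (Fintype.sum_sum_type fun e : Γ.B ⊕ Γ.A =>
        edgeTerm (V := Γ.V ⊕ Γ.A) pa qa (Γ.replace.endsA e) x y))
    (Fintype.sum_sum_type fun e : Γ.A ⊕ Γ.A =>
      edgeTerm (V := Γ.V ⊕ Γ.A) pb qb (Γ.replace.endsB e) x y)

theorem LGraph.weighted_replace_inl_inl {R : Type*} [CommRing R] (Γ : LGraph)
    (μ pa qa pb qb : R) (x y : Γ.V) :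
    Γ.replace.weighted μ pa qa pb qb (Sum.inl x : Γ.V ⊕ Γ.A) (Sum.inl y : Γ.V ⊕ Γ.A) =
      (if x = y then μ else 0) + ∑ e, edgeTerm pa qa (Γ.endsB e) x y +
        ∑ e, edgeTerm pb 0 (Γ.endsA e) x y := by
  rw [LGraph.weighted_replace_apply, ← Finset.sum_add_distrib]
  simp [edgeTerm, mul_add]

theorem LGraph.weighted_replace_inl_inr {R : Type*} [CommRing R] (Γ : LGraph)
    (μ pa qa pb qb : R) (x : Γ.V) (e : Γ.A) :
    Γ.replace.weighted μ pa qa pb qb (Sum.inl x : Γ.V ⊕ Γ.A) (Sum.inr e : Γ.V ⊕ Γ.A) =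
      qb * ((if x = (Γ.endsA e).1 then 1 else 0) + if x = (Γ.endsA e).2 then 1 else 0) := by
  rw [LGraph.weighted_replace_apply, mul_add,
    Finset.sum_eq_single e (f := fun e => edgeTerm pb qb (Sum.inl _, Sum.inr e) _ _),
    Finset.sum_eq_single e (f := fun e => edgeTerm pb qb (Sum.inr e, Sum.inl _) _ _)]
  · simp [edgeTerm]
  all_goals simp +contextual [edgeTerm, eq_comm]

theorem LGraph.weighted_replace_inr_inl {R : Type*} [CommRing R] (Γ : LGraph)
    (μ pa qa pb qb : R) (x : Γ.V) (e : Γ.A) :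
    Γ.replace.weighted μ pa qa pb qb (Sum.inr e : Γ.V ⊕ Γ.A) (Sum.inl x : Γ.V ⊕ Γ.A) =
      qb * ((if x = (Γ.endsA e).1 then 1 else 0) + if x = (Γ.endsA e).2 then 1 else 0) := by
  rw [LGraph.weighted_replace_apply, mul_add,
    Finset.sum_eq_single e (f := fun e => edgeTerm pb qb (Sum.inl _, Sum.inr e) _ _),
    Finset.sum_eq_single e (f := fun e => edgeTerm pb qb (Sum.inr e, Sum.inl _) _ _)]
  · simp [edgeTerm]
  all_goals simp +contextual [edgeTerm, eq_comm]

theorem LGraph.weighted_replace_inr_inr {R : Type*} [CommRing R] (Γ : LGraph)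
    (μ pa qa pb qb : R) (e e' : Γ.A) :
    Γ.replace.weighted μ pa qa pb qb (Sum.inr e : Γ.V ⊕ Γ.A) (Sum.inr e' : Γ.V ⊕ Γ.A) =
      if e = e' then μ + 2 * pb + 2 * pa + 2 * qa else 0 := by
  rw [LGraph.weighted_replace_apply]
  by_cases h : e = e'
  · subst h
    rw [Finset.sum_eq_single e (f := fun e => edgeTerm pa qa (Sum.inr e, Sum.inr e) _ _)]
    · simp [edgeTerm]
      ring
    all_goals simp +contextual [edgeTerm, eq_comm]
  · rw [Finset.sum_eq_zero (f := fun e => edgeTerm pa qa (Sum.inr e, Sum.inr e) _ _)]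
    · simp [edgeTerm, h]
    · intro a _
      by_cases ha : e = a <;> simp [edgeTerm, ha]
      simp [← ha, Ne.symm h]

/-- The new vertices form the scalar block `D • 1`. Its Schur complement subtracts, for each
`a`-edge `wz`, `qb ^ 2 / D` times the square of the vector `δ_w + δ_z`, which is again an edge term,
with equal diagonal and off-diagonal weights. The labels swap because the `a`-edges between old
vertices come from `b`-edges. -/
theorem LGraph.minor_replace {K : Type*} [Field K] (Γ : LGraph) (S : Set Γ.V)
    (μ pa qa pb qb : K) (hD : μ + 2 * pb + 2 * pa + 2 * qa ≠ 0) :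
    Γ.replace.minor (Sum.inl '' S : Set (Γ.V ⊕ Γ.A)) μ pa qa pb qb =
      (μ + 2 * pb + 2 * pa + 2 * qa) ^ Fintype.card Γ.A *
        Γ.minor S μ (pb - qb ^ 2 / (μ + 2 * pb + 2 * pa + 2 * qa))
          (-(qb ^ 2 / (μ + 2 * pb + 2 * pa + 2 * qa))) pa qa := by
  let _ : Fintype {x : Γ.V // x ∉ S} := Fintype.ofFinite _
  let _ : Fintype {x : Γ.V ⊕ Γ.A // x ∉ Sum.inl '' S} := Fintype.ofFinite _
  set D := μ + 2 * pb + 2 * pa + 2 * qa with hDdef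
  let M : Matrix (Γ.V ⊕ Γ.A) (Γ.V ⊕ Γ.A) K := Γ.replace.weighted μ pa qa pb qb
  have hM : Γ.replace.minor (Sum.inl '' S : Set (Γ.V ⊕ Γ.A)) μ pa qa pb qb =
      (M.submatrix (Subtype.val : {x // x ∉ Sum.inl '' S} → _) Subtype.val).det := rfl
  let P : Matrix {x : Γ.V // x ∉ S} {x : Γ.V // x ∉ S} K :=
    Matrix.of fun x y => M (Sum.inl x.1) (Sum.inl y.1)
  let N : Matrix {x : Γ.V // x ∉ S} Γ.A K := Matrix.of fun x e =>
    qb * ((if x.1 = (Γ.endsA e).1 then 1 else 0) + if x.1 = (Γ.endsA e).2 then 1 else 0)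
  have hblocks : (M.submatrix (Subtype.val : {x // x ∉ Sum.inl '' S} → _) Subtype.val).submatrix
      (complEquiv S) (complEquiv S) = Matrix.fromBlocks P N N.transpose (D • 1) := by
    ext (x | e) (y | e')
    · rfl
    · exact Γ.weighted_replace_inl_inr ..
    · exact Γ.weighted_replace_inr_inl ..
    · refine (Γ.weighted_replace_inr_inr ..).trans ?_
      simp [Matrix.one_apply, hDdef]
  let _ : Invertible (D • (1 : Matrix Γ.A Γ.A K)) :=
    ⟨D⁻¹ • 1, by simp [hD], by simp [hD]⟩
  rw [hM, ← Matrix.det_submatrix_equiv_self (complEquiv S), hblocks, Matrix.det_fromBlocks₂₂,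
    Matrix.det_smul, Matrix.det_one, mul_one]
  refine congrArg (D ^ Fintype.card Γ.A * Matrix.det ·) ?_
  ext x y
  have hP : P x y = _ := Γ.weighted_replace_inl_inl μ pa qa pb qb x.1 y.1
  have hS : (N * (D⁻¹ • (1 : Matrix Γ.A Γ.A K)) * N.transpose) x y =
      ∑ e, qb ^ 2 / D * (((if x.1 = (Γ.endsA e).1 then 1 else 0) +
          if x.1 = (Γ.endsA e).2 then 1 else 0) *
        ((if y.1 = (Γ.endsA e).1 then 1 else 0) + if y.1 = (Γ.endsA e).2 then 1 else 0)) := by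
    rw [Matrix.mul_smul, Matrix.mul_one, Matrix.smul_mul, Matrix.smul_apply, Matrix.mul_apply,
      Finset.smul_sum]
    refine Finset.sum_congr rfl fun e _ => ?_
    simp only [N, Matrix.transpose_apply, Matrix.of_apply, smul_eq_mul]
    ring
  change P x y - (N * (D⁻¹ • (1 : Matrix Γ.A Γ.A K)) * N.transpose) x y = _
  rw [hP, hS]
  simp only [Matrix.submatrix_apply, LGraph.weighted, Matrix.of_apply]
  rw [add_sub_assoc, ← Finset.sum_sub_distrib, add_assoc, add_assoc, add_right_inj, add_comm]
  refine congrArg (· + _) (Finset.sum_congr rfl fun e _ => ?_)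
  simp only [edgeTerm]
  ring

/-- The interior determinant of `G n` with the given edge terms. -/
noncomputable def interiorDet {R : Type*} [CommRing R] (n : ℕ) (μ pa qa pb qb : R) : R :=
  (G n).minor (Set.range (boundaryPt n)) μ pa qa pb qb

theorem interiorDet_zero {R : Type*} [CommRing R] (μ pa qa pb qb : R) :
    interiorDet 0 μ pa qa pb qb = 1 := by
  have : IsEmpty {x : (G 0).V // x ∉ Set.range (boundaryPt 0)} := ⟨fun x => x.2 ⟨x.1, rfl⟩⟩
  exact Matrix.det_isEmpty

theorem interiorDet_succ {K : Type*} [Field K] (n : ℕ) (μ pa qa pb qb : K)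
    (hD : μ + 2 * pb + 2 * pa + 2 * qa ≠ 0) :
    interiorDet (n + 1) μ pa qa pb qb =
      (μ + 2 * pb + 2 * pa + 2 * qa) ^ Fintype.card (G n).A *
        interiorDet n μ (pb - qb ^ 2 / (μ + 2 * pb + 2 * pa + 2 * qa))
          (-(qb ^ 2 / (μ + 2 * pb + 2 * pa + 2 * qa))) pa qa := by
  rw [interiorDet, interiorDet, ← LGraph.minor_replace _ _ _ _ _ _ _ hD]
  have : Set.range (boundaryPt (n + 1)) =
      (Sum.inl '' Set.range (boundaryPt n) : Set ((G n).V ⊕ (G n).A)) := by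
    rw [← Set.range_comp]; rfl
  rw [this]; rfl

theorem c_map {K : Type*} [Field K] (f : ℝ[X] →+* K) (n : ℕ) :
    f (c n) = interiorDet n (f X) (-1) 1 (-1) 1 := by
  rw [c, Matrix.charpoly, RingHom.map_det]
  refine congrArg Matrix.det ?_
  ext x y
  have h : (dirichletLaplacian n).charmatrix x y = (if x.1 = y.1 then X else 0) +
      ∑ e, C (edgeTerm (-1) 1 ((G n).endsA e) x.1 y.1) +
      ∑ e, C (edgeTerm (-1) 1 ((G n).endsB e) x.1 y.1) := by
    rw [Matrix.charmatrix_apply, dirichletLaplacian, Matrix.submatrix_apply,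
      LGraph.laplacian_apply, Matrix.diagonal_apply]
    simp only [Subtype.ext_iff, map_neg, map_add, map_sum]
    ring
  rw [RingHom.mapMatrix_apply, Matrix.map_apply, h]
  simp only [map_add, map_sum, map_edgeTerm, apply_ite f, map_zero, map_neg, map_one,
    Matrix.submatrix_apply, LGraph.weighted, Matrix.of_apply]

theorem card_A_add_two (n : ℕ) :
    Fintype.card (G (n + 2)).A = Fintype.card (G (n + 1)).A + 2 * Fintype.card (G n).A := by
  have hA : Fintype.card (G (n + 2)).A =
      Fintype.card ((G (n + 1)).B ⊕ (G (n + 1)).A) := rfl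
  have hB : Fintype.card (G (n + 1)).B = Fintype.card ((G n).A ⊕ (G n).A) := rfl
  rw [hA, Fintype.card_sum, hB, Fintype.card_sum]
  ring

theorem card_A_zero : Fintype.card (G 0).A = 1 := rfl

theorem card_A_one : Fintype.card (G 1).A = 1 := rfl

/-! ### The polynomial recursion and its identities -/

/-- The data produced by the polynomial recursion: three consecutive factors `g₀, g₁, g₂`, two
consecutive numerators `e₀, e₁` and denominators `p₀, p₁` of the coupling coefficients, and
auxiliary polynomials `x, z, t` that make the recursion free of divisions. -/
structure FactorState where
  g₀ : ℝ[X]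
  g₁ : ℝ[X]
  g₂ : ℝ[X]
  e₀ : ℝ[X]
  e₁ : ℝ[X]
  p₀ : ℝ[X]
  p₁ : ℝ[X]
  x : ℝ[X]
  z : ℝ[X]
  t : ℝ[X]

/-- One step of the polynomial recursion. -/
noncomputable def FactorState.next (s : FactorState) : FactorState where
  g₀ := s.g₁
  g₁ := s.g₂
  g₂ := s.g₁ * (8 * (s.g₀ * s.e₀ ^ 2) * s.e₁ + s.x * s.t) - 2 * s.g₂ * (s.g₀ * s.e₀ ^ 2)
  e₀ := s.e₁
  e₁ := s.g₀ * s.e₀ ^ 2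
  p₀ := s.p₁
  p₁ := s.g₀ * s.p₀
  x := s.x * s.z
  z := 8 * (s.g₀ * s.e₀ ^ 2) * s.e₁ + s.x * s.t
  t := s.g₀ * s.t - 2 * s.p₁ * s.e₁

/-- The states of the polynomial recursion. -/
noncomputable def factorState : ℕ → FactorState
  | 0 =>
    -- The first pivot is `X + 2(-1) + 2(-1) + 2 = X - 2`; both labels start with coupling 1, hence
    -- the numerators `-1`.
    { g₀ := 1
      g₁ := X - 2
      g₂ := X ^ 2 - 6 * X + 4
      e₀ := -1
      e₁ := -1
      p₀ := 1
      p₁ := 1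
      x := X ^ 2 - 4 * X
      z := X ^ 2 - 8 * X + 8
      t := X - 6 }
  | n + 1 => (factorState n).next

/-- The factors `γ_n`. -/
noncomputable def fac (n : ℕ) : ℝ[X] := (factorState n).g₀

/-- The numerators of the coupling coefficients. -/
noncomputable def num (n : ℕ) : ℝ[X] := (factorState n).e₀

/-- The denominators of the coupling coefficients. -/
noncomputable def den (n : ℕ) : ℝ[X] := (factorState n).p₀

/-- The cofactor of `den n` in `fac (n + 2) - 2 * fac (n + 1) * num (n + 1)`. -/
noncomputable def cofX (n : ℕ) : ℝ[X] := (factorState n).x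

/-- The cofactor of `fac n` in `fac (n + 2) + 2 * fac (n + 1) * num (n + 1)`. -/
noncomputable def cofZ (n : ℕ) : ℝ[X] := (factorState n).z

/-- The auxiliary polynomial in the recursion of `cofZ`. -/
noncomputable def cofT (n : ℕ) : ℝ[X] := (factorState n).t

theorem fac_zero : fac 0 = 1 := rfl

theorem fac_one : fac 1 = X - 2 := rfl

theorem fac_two : fac 2 = X ^ 2 - 6 * X + 4 := rfl

theorem num_zero : num 0 = -1 := rfl

theorem num_one : num 1 = -1 := rfl

theorem den_zero : den 0 = 1 := rfl

theorem den_one : den 1 = 1 := rfl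

theorem cofX_zero : cofX 0 = X ^ 2 - 4 * X := rfl

theorem cofZ_zero : cofZ 0 = X ^ 2 - 8 * X + 8 := rfl

theorem cofT_zero : cofT 0 = X - 6 := rfl

theorem num_add_two (n : ℕ) : num (n + 2) = fac n * num n ^ 2 := rfl

theorem den_add_two (n : ℕ) : den (n + 2) = fac n * den n := rfl

theorem cofX_succ (n : ℕ) : cofX (n + 1) = cofX n * cofZ n := rfl

theorem cofZ_succ (n : ℕ) :
    cofZ (n + 1) = 8 * num (n + 2) * num (n + 1) + cofX n * cofT n := rfl

theorem cofT_succ (n : ℕ) :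
    cofT (n + 1) = fac n * cofT n - 2 * den (n + 1) * num (n + 1) := rfl

theorem fac_add_three (n : ℕ) :
    fac (n + 3) = fac (n + 1) * cofZ (n + 1) - 2 * fac (n + 2) * num (n + 2) := rfl

theorem fac_add_two_eq_cofZ (n : ℕ) :
    fac (n + 2) = fac n * cofZ n - 2 * fac (n + 1) * num (n + 1) := by
  cases n with
  | zero => rw [fac_two, fac_zero, fac_one, cofZ_zero, num_one]; ring
  | succ n => exact fac_add_three n

/-- The first two identities drive the induction. The fourth is a difference of squares: in its step
the two factors are `den n * cofX n` and `fac n * cofZ n`, which explains the recursion of `cofX`.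
-/
theorem fac_identities (n : ℕ) :
    fac (n + 2) = 2 * fac (n + 1) * num (n + 1) + den n * cofX n ∧
    4 * den (n + 2) * num n ^ 2 + den (n + 1) * cofZ n = fac (n + 1) * cofT n ∧
    cofT n * fac n = 4 * den (n + 1) * num (n + 1) + den n * fac (n + 1) ∧
    fac (n + 1) ^ 2 - 4 * fac n ^ 2 * num n ^ 2 = den (n + 1) * cofX n := by
  induction n with
  | zero =>
    simp only [zero_add, den_add_two, fac_zero, fac_one, fac_two, num_zero, num_one, den_zero,
      den_one, cofX_zero, cofZ_zero, cofT_zero]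
    refine ⟨?_, ?_, ?_, ?_⟩ <;> ring
  | succ n ih =>
    obtain ⟨h1, h3, h4, h5⟩ := ih
    have h2 := fac_add_two_eq_cofZ n
    simp only [add_assoc, Nat.reduceAdd]
    rw [fac_add_three, den_add_two (n + 1), cofX_succ, cofT_succ, cofZ_succ]
    have hd := den_add_two n
    have hn := num_add_two n
    refine ⟨?_, ?_, ?_, ?_⟩
    · rw [hn]; rw [hd] at h3
      linear_combination (-4 * (fac n * num n ^ 2)) * h1 - cofX n * h3
    · rw [hn, hd]; rw [hd] at h3
      linear_combination (-fac n * cofT n) * h1 + 2 * fac n * num (n + 1) * h3 +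
        2 * den (n + 1) * num (n + 1) * h2
    · rw [hn, hd]; rw [hd] at h3
      linear_combination (-fac n) * h3 - den (n+1) * h2
    · rw [hd]
      linear_combination (fac (n+2) + 2 * fac (n+1) * num (n+1)) * h1 + den n * cofX n * h2

/-- This is `pivot_succ` with denominators cleared, arranged so that the leading term stands first.
-/
theorem fac_add_two_mul_den (n : ℕ) :
    fac (n + 2) * den (n + 1) = fac (n + 1) ^ 2 * den n +
      (2 * num (n + 1) * fac (n + 1) * den (n + 1) - 4 * num (n + 2) * fac n * den n) := by
  obtain ⟨h1, -, -, h5⟩ := fac_identities n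
  rw [num_add_two]
  linear_combination den (n + 1) * h1 - den n * h5

/-! ### Monicity and degrees -/

/-- The bounds on `num` say that the couplings are bounded at infinity; they make `fac (n + 1) ^ 2 *
den n` dominate in `fac_add_two_mul_den`, and the monic `den (n + 1)` can be divided out. -/
theorem fac_monic_aux (n : ℕ) :
    (fac n).Monic ∧ (fac (n + 1)).Monic ∧ (den n).Monic ∧ (den (n + 1)).Monic ∧
    (fac (n + 1)).natDegree = 1 + (fac n).natDegree + (den (n + 1)).natDegree ∧
    (num n).natDegree ≤ (den (n + 1)).natDegree ∧
    (num (n + 1)).natDegree ≤ (den (n + 2)).natDegree := by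
  induction n with
  | zero =>
    simp only [zero_add, fac_zero, fac_one, den_zero, den_one, num_zero, num_one, den_add_two]
    have h : (X - 2 : ℝ[X]) = X - C 2 := congrArg (X - ·) (C_ofNat 2).symm
    rw [h]
    refine ⟨monic_one, monic_X_sub_C 2, monic_one, monic_one, ?_, ?_, ?_⟩ <;>
      simp
  | succ n ih =>
    obtain ⟨hg, hg1, hp, hp1, hd, he, he1⟩ := ih
    have hp2 : (den (n + 2)).Monic := hg.mul hp
    have hd2 : (den (n + 2)).natDegree = (fac n).natDegree + (den n).natDegree :=
      hg.natDegree_mul hp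
    have hd3 : (den (n + 3)).natDegree = (fac (n + 1)).natDegree + (den (n + 1)).natDegree :=
      hg1.natDegree_mul hp1
    have he2 : (num (n + 2)).natDegree ≤ (fac n).natDegree + 2 * (num n).natDegree := by
      rw [num_add_two]
      exact natDegree_mul_le.trans (Nat.add_le_add_left natDegree_pow_le _)
    have hlead : (fac (n + 1) ^ 2 * den n).IsMonicOfDegree
        (2 * (fac (n + 1)).natDegree + (den n).natDegree) :=
      ⟨by rw [(hg1.pow 2).natDegree_mul hp, hg1.natDegree_pow], (hg1.pow 2).mul hp⟩
    have hrest : (2 * num (n + 1) * fac (n + 1) * den (n + 1) -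
        4 * num (n + 2) * fac n * den n).natDegree <
        2 * (fac (n + 1)).natDegree + (den n).natDegree := by
      refine (natDegree_sub_le _ _).trans_lt (max_lt ?_ ?_)
      · have h1 := natDegree_mul_le (p := 2 * num (n + 1) * fac (n + 1)) (q := den (n + 1))
        have h2 := natDegree_mul_le (p := 2 * num (n + 1)) (q := fac (n + 1))
        have h3 := natDegree_mul_le (p := (2 : ℝ[X])) (q := num (n + 1))
        have h4 : (2 : ℝ[X]).natDegree = 0 := natDegree_ofNat 2
        omega
      · have h1 := natDegree_mul_le (p := 4 * num (n + 2) * fac n) (q := den n)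
        have h2 := natDegree_mul_le (p := 4 * num (n + 2)) (q := fac n)
        have h3 := natDegree_mul_le (p := (4 : ℝ[X])) (q := num (n + 2))
        have h4 : (4 : ℝ[X]).natDegree = 0 := natDegree_ofNat 4
        omega
    have hsum := hlead.add_right hrest
    rw [← fac_add_two_mul_den] at hsum
    have hg2 : (fac (n + 2)).Monic := hp1.of_mul_monic_right hsum.monic
    have hdeg := hsum.natDegree_eq
    rw [hg2.natDegree_mul hp1] at hdeg
    refine ⟨hg1, hg2, hp1, hp2, ?_, he1, ?_⟩
    · change (fac (n + 2)).natDegree = 1 + (fac (n + 1)).natDegree + (den (n + 2)).natDegree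
      omega
    · change (num (n + 2)).natDegree ≤ (den (n + 3)).natDegree
      omega

theorem fac_monic (n : ℕ) : (fac n).Monic := (fac_monic_aux n).1

theorem den_monic (n : ℕ) : (den n).Monic := (fac_monic_aux n).2.2.1

theorem natDegree_fac_succ (n : ℕ) :
    (fac (n + 1)).natDegree = 1 + (fac n).natDegree + (den (n + 1)).natDegree :=
  (fac_monic_aux n).2.2.2.2.1

theorem natDegree_den_add_two (n : ℕ) :
    (den (n + 2)).natDegree = (fac n).natDegree + (den n).natDegree :=
  (fac_monic n).natDegree_mul (den_monic n)

theorem natDegree_fac_zero : (fac 0).natDegree = 0 := natDegree_one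

theorem natDegree_fac_one : (fac 1).natDegree = 1 := by
  rw [natDegree_fac_succ 0, natDegree_fac_zero, den_one, natDegree_one]

theorem natDegree_fac_two : (fac 2).natDegree = 2 := by
  rw [natDegree_fac_succ 1, natDegree_fac_one, natDegree_den_add_two 0, natDegree_fac_zero,
    den_zero, natDegree_one]

theorem natDegree_fac_add_three (n : ℕ) :
    (fac (n + 3)).natDegree + (fac n).natDegree =
      (fac (n + 2)).natDegree + 2 * (fac (n + 1)).natDegree := by
  have h1 := natDegree_fac_succ (n + 2)
  have h2 := natDegree_fac_succ (n + 1)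
  have h3 := natDegree_fac_succ n
  have h4 := natDegree_den_add_two (n + 1)
  simp only [add_assoc, Nat.reduceAdd] at h1 h2 h3 h4
  omega

/-! ### Pairwise coprimality -/

theorem isCoprime_of_dvd_sub {R : Type*} [CommRing R] {a b b' : R} (h : IsCoprime a b)
    (hd : a ∣ b' - b) : IsCoprime a b' := by
  obtain ⟨q, hq⟩ := hd
  rw [show b' = b + a * q by rw [← hq]; ring]
  exact h.add_mul_left_right q

theorem isCoprime_ofNat (a : ℝ[X]) (m : ℕ) [m.AtLeastTwo] : IsCoprime a (ofNat(m) : ℝ[X]) := by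
  have h : IsUnit (ofNat(m) : ℝ[X]) := by
    rw [← C_ofNat]
    exact isUnit_C.2 (isUnit_iff_ne_zero.2 (OfNat.ofNat_ne_zero m))
  rw [← mul_one (ofNat(m) : ℝ[X])]
  exact (isCoprime_mul_unit_left_right h a 1).2 isCoprime_one_right

theorem isCoprime_num {a : ℝ[X]} :
    ∀ n, (∀ k, k + 2 ≤ n → k % 2 = n % 2 → IsCoprime a (fac k)) → IsCoprime a (num n)
  | 0, _ => num_zero ▸ isCoprime_one_right.neg_right
  | 1, _ => num_one ▸ isCoprime_one_right.neg_right
  | n + 2, h => (h n le_rfl (by omega)).mul_right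
      (isCoprime_num n fun k hk hk' => h k (by omega) (by omega)).pow_right

theorem isCoprime_den {a : ℝ[X]} :
    ∀ n, (∀ k, k + 2 ≤ n → k % 2 = n % 2 → IsCoprime a (fac k)) → IsCoprime a (den n)
  | 0, _ => isCoprime_one_right
  | 1, _ => isCoprime_one_right
  | n + 2, h => (h n le_rfl (by omega)).mul_right
      (isCoprime_den n fun k hk hk' => h k (by omega) (by omega))

theorem fac_dvd_num (k : ℕ) : ∀ n, k + 2 ≤ n → k % 2 = n % 2 → fac k ∣ num n
  | 0, h, _ => by omega
  | 1, h, _ => by omega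
  | n + 2, h, h' => by
    rw [num_add_two]
    rcases eq_or_ne k n with rfl | hkn
    · exact dvd_mul_right _ _
    · exact dvd_mul_of_dvd_right
        (dvd_pow (fac_dvd_num k n (by omega) (by omega)) two_ne_zero) _

theorem fac_dvd_den (k : ℕ) : ∀ n, k + 2 ≤ n → k % 2 = n % 2 → fac k ∣ den n
  | 0, h, _ => by omega
  | 1, h, _ => by omega
  | n + 2, h, h' => by
    rw [den_add_two]
    rcases eq_or_ne k n with rfl | hkn
    · exact dvd_mul_right _ _
    · exact dvd_mul_of_dvd_right (fac_dvd_den k n (by omega) (by omega)) _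

/-- Modulo `fac (n + 1)` only the last term survives. This settles coprimality of `fac k` and `cofZ
k`, about which `fac_add_two_eq_cofZ` says nothing. -/
theorem fac_mul_cofZ_succ (n : ℕ) :
    fac n * cofZ (n + 1) = fac (n + 1) * (4 * num (n + 1) * fac (n + 1) + cofX n * den n) -
      8 * num (n + 1) * fac n ^ 2 * num n ^ 2 := by
  obtain ⟨-, -, h4, h5⟩ := fac_identities n
  rw [cofZ_succ, num_add_two]
  linear_combination cofX n * h4 - 4 * num (n + 1) * h5

/-- Reduce `fac (n + 2)` modulo `fac k`. For `k < n` of the parity of `n`, `fac k` divides `den n`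
and `2 * fac (n + 1) * num (n + 1)` remains; for the other parity it divides that product and `den n
* cofX n` remains, which is why `cofX` is carried along. The case `k = n` uses `cofZ`. -/
theorem isCoprime_fac_aux (n : ℕ) :
    (∀ k ≤ n + 1, ∀ j ≤ n + 1, j ≠ k → IsCoprime (fac k) (fac j)) ∧
    ∀ k ≤ n + 1, IsCoprime (fac k) (cofX n) := by
  induction n with
  | zero =>
    have h1 : IsCoprime (fac 1) (cofX 0) := by
      rw [fac_one, cofX_zero]
      exact isCoprime_of_dvd_sub ((isCoprime_ofNat _ 4).neg_right) ⟨X - 2, by ring⟩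
    constructor
    · intro k hk j hj hjk
      interval_cases k <;> interval_cases j <;> first | contradiction | skip
      exacts [isCoprime_one_left, isCoprime_one_right]
    · intro k hk
      interval_cases k
      exacts [isCoprime_one_left, h1]
  | succ n ih =>
    obtain ⟨hg, hx⟩ := ih
    have h1 := (fac_identities n).1
    have h2 := fac_add_two_eq_cofZ n
    have hnum : ∀ k ≤ n + 1, k % 2 = n % 2 →
        IsCoprime (fac k) (2 * fac (n + 1) * num (n + 1)) := fun k hk hkn =>
      ((isCoprime_ofNat _ 2).mul_right (hg k hk _ le_rfl (by rintro rfl; omega))).mul_right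
        (isCoprime_num _ fun j hj hjn => hg k hk j (by omega) (by rintro rfl; omega))
    have hden : ∀ k ≤ n + 1, k % 2 ≠ n % 2 → IsCoprime (fac k) (den n * cofX n) :=
      fun k hk hkn =>
        (isCoprime_den _ fun j hj hjn => hg k hk j (by omega) (by rintro rfl; omega)).mul_right
          (hx k hk)
    have hdvd : ∀ k ≤ n + 1, k % 2 ≠ n % 2 → fac k ∣ 2 * fac (n + 1) * num (n + 1) := by
      intro k hk hkn
      rcases eq_or_ne k (n + 1) with rfl | hne
      · exact dvd_mul_of_dvd_left (dvd_mul_left _ _) _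
      · exact dvd_mul_of_dvd_right (fac_dvd_num k _ (by omega) (by omega)) _
    have hnew : ∀ k ≤ n + 1, IsCoprime (fac k) (fac (n + 2)) := by
      intro k hk
      by_cases hkn : k % 2 = n % 2
      · rcases eq_or_ne k n with rfl | hne
        · exact isCoprime_of_dvd_sub (hnum k hk hkn).neg_right ⟨cofZ k, by rw [h2]; ring⟩
        · refine isCoprime_of_dvd_sub (hnum k hk hkn) ?_
          rw [h1, add_sub_cancel_left]
          exact dvd_mul_of_dvd_left (fac_dvd_den k n (by omega) hkn) _
      · refine isCoprime_of_dvd_sub (hden k hk hkn) ?_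
        rw [h1, add_sub_cancel_right]
        exact hdvd k hk hkn
    have hnum2 : IsCoprime (fac (n + 2)) (2 * fac (n + 1) * num (n + 1)) :=
      ((isCoprime_ofNat _ 2).mul_right (hnew _ le_rfl).symm).mul_right
        (isCoprime_num _ fun j hj _ => (hnew j (by omega)).symm)
    -- `fac n * cofZ n` differs from `den n * cofX n + 2 * fac (n + 1) * num (n + 1)` only by
    -- another copy of the second term, so the same reductions apply except at `k = n`.
    have hz : ∀ k ≤ n + 2, IsCoprime (fac k) (fac n * cofZ n) ∨ k = n := by
      intro k hk
      have hz' : fac n * cofZ n = fac (n + 2) + 2 * fac (n + 1) * num (n + 1) := by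
        rw [h2]; ring
      rcases eq_or_ne k (n + 2) with rfl | hne
      · exact Or.inl (isCoprime_of_dvd_sub hnum2 ⟨1, by rw [hz']; ring⟩)
      rcases eq_or_ne k n with rfl | hkn'
      · exact Or.inr rfl
      left
      by_cases hkn : k % 2 = n % 2
      · refine isCoprime_of_dvd_sub ((isCoprime_ofNat _ 2).mul_right (hnum k (by omega) hkn)) ?_
        rw [hz', h1, show ∀ a b : ℝ[X], a + b + a - 2 * a = b by intros; ring]
        exact dvd_mul_of_dvd_left (fac_dvd_den k n (by omega) hkn) _
      · refine isCoprime_of_dvd_sub (hnew k (by omega)) ?_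
        rw [hz', add_sub_cancel_left]
        exact hdvd k (by omega) hkn
    have hzn : IsCoprime (fac n) (cofZ n) := by
      cases n with
      | zero => exact isCoprime_one_left
      | succ m =>
        have hj : ∀ j ≤ m, IsCoprime (fac (m + 1)) (fac j) := fun j hj =>
          hg _ (by omega) j (by omega) (by omega)
        have h : IsCoprime (fac (m + 1)) (8 * num (m + 1) * fac m ^ 2 * num m ^ 2) :=
          (((isCoprime_ofNat _ 8).mul_right
            (isCoprime_num _ fun j hj' _ => hj j (by omega))).mul_right
              (hj m le_rfl).pow_right).mul_right
                (isCoprime_num _ fun j hj' _ => hj j (by omega)).pow_right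
        have h' : IsCoprime (fac (m + 1)) (fac m * cofZ (m + 1)) :=
          isCoprime_of_dvd_sub h.neg_right ⟨_, by rw [fac_mul_cofZ_succ, sub_neg_eq_add,
            sub_add_cancel]⟩
        exact h'.of_mul_right_right
    have hznew : ∀ k ≤ n + 2, IsCoprime (fac k) (cofZ n) := by
      intro k hk
      rcases hz k hk with h | rfl
      exacts [h.of_mul_right_right, hzn]
    constructor
    · intro k hk j hj hjk
      rcases Nat.lt_or_ge k (n + 2) with hk' | hk' <;> rcases Nat.lt_or_ge j (n + 2) with hj' | hj'
      · exact hg k (by omega) j (by omega) hjk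
      · obtain rfl : j = n + 2 := by omega
        exact hnew k (by omega)
      · obtain rfl : k = n + 2 := by omega
        exact (hnew j (by omega)).symm
      · omega
    · intro k hk
      rw [cofX_succ]
      refine IsCoprime.mul_right ?_ (hznew k hk)
      rcases Nat.lt_or_ge k (n + 2) with hk' | hk'
      · exact hx k (by omega)
      · obtain rfl : k = n + 2 := by omega
        have h : IsCoprime (fac (n + 2)) (den n * cofX n) :=
          isCoprime_of_dvd_sub hnum2.neg_right ⟨1, by rw [h1]; ring⟩
        exact h.of_mul_right_right

theorem isCoprime_fac {j k : ℕ} (h : j ≠ k) : IsCoprime (fac j) (fac k) :=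
  (isCoprime_fac_aux (j + k)).1 j (by omega) k (by omega) h.symm

/-! ### The characteristic polynomial as a product of pivots -/

/-- The pivot of the elimination of the vertices that are added in step `n + 1`. -/
noncomputable def pivot (n : ℕ) : RatFunc ℝ :=
  algebraMap ℝ[X] (RatFunc ℝ) (fac (n + 1)) /
    (algebraMap ℝ[X] (RatFunc ℝ) (fac n) * algebraMap ℝ[X] (RatFunc ℝ) (den (n + 1)))

theorem algebraMap_fac_ne_zero (n : ℕ) : algebraMap ℝ[X] (RatFunc ℝ) (fac n) ≠ 0 :=
  RatFunc.algebraMap_ne_zero (fac_monic n).ne_zero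

theorem algebraMap_den_ne_zero (n : ℕ) : algebraMap ℝ[X] (RatFunc ℝ) (den n) ≠ 0 :=
  RatFunc.algebraMap_ne_zero (den_monic n).ne_zero

theorem pivot_ne_zero (n : ℕ) : pivot n ≠ 0 :=
  div_ne_zero (algebraMap_fac_ne_zero _)
    (mul_ne_zero (algebraMap_fac_ne_zero _) (algebraMap_den_ne_zero _))

/-- The coupling of the endpoints of a `b`-edge after `n` eliminations. -/
noncomputable def coupling (n : ℕ) : RatFunc ℝ :=
  -(algebraMap ℝ[X] (RatFunc ℝ) (num n) / algebraMap ℝ[X] (RatFunc ℝ) (den (n + 1)))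

theorem coupling_sq_div_pivot (n : ℕ) : coupling n ^ 2 / pivot n = -coupling (n + 2) := by
  have h1 := algebraMap_fac_ne_zero n
  have h2 := algebraMap_fac_ne_zero (n + 1)
  have h3 := algebraMap_den_ne_zero (n + 1)
  rw [coupling, coupling, pivot, num_add_two, den_add_two (n + 1)]
  simp only [map_mul, map_pow]
  field_simp

/-- A pivot is `μ + 2pb + 2pa + 2qa`, and elimination replaces `(pa, qa, pb)` by `(pb + q, q, pa)`
with `q = coupling (n + 2)`; the change is `4q - 2qa`. -/
theorem pivot_succ (n : ℕ) :
    pivot (n + 1) = pivot n - 2 * coupling (n + 1) + 4 * coupling (n + 2) := by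
  have h1 := algebraMap_fac_ne_zero n
  have h2 := algebraMap_fac_ne_zero (n + 1)
  have h3 := algebraMap_den_ne_zero (n + 1)
  have h4 := algebraMap_den_ne_zero n
  have h := congrArg (algebraMap ℝ[X] (RatFunc ℝ)) (fac_add_two_mul_den n)
  simp only [coupling, pivot, add_assoc, Nat.reduceAdd]
  rw [den_add_two (n + 1), den_add_two n]
  simp only [map_mul, map_pow, map_add, map_sub, map_ofNat] at h ⊢
  field_simp
  linear_combination h

/-- The diagonal weights enter the pivots only through the sum fixed by `h`, so they can stay
arbitrary in the induction. -/
theorem interiorDet_eq_prod (n k : ℕ) (pa pb : RatFunc ℝ)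
    (h : algebraMap ℝ[X] (RatFunc ℝ) X + 2 * pb + 2 * pa + 2 * coupling (k + 1) = pivot k) :
    interiorDet n (algebraMap ℝ[X] (RatFunc ℝ) X) pa (coupling (k + 1)) pb (coupling k) =
      ∏ j ∈ Finset.range n, pivot (k + j) ^ Fintype.card (G (n - 1 - j)).A := by
  induction n generalizing k pa pb with
  | zero => exact interiorDet_zero ..
  | succ n ih =>
    rw [interiorDet_succ n _ _ _ _ _ (h ▸ pivot_ne_zero k), h, coupling_sq_div_pivot, neg_neg,
      ih (k + 1), Finset.prod_range_succ', mul_comm]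
    · refine congrArg₂ (· * ·) (Finset.prod_congr rfl fun j _ => ?_) rfl
      rw [show k + 1 + j = k + (j + 1) by ring, show n + 1 - 1 - (j + 1) = n - 1 - j by omega]
    · rw [pivot_succ, ← h]
      ring

theorem c_eq_prod_pivot (n : ℕ) : algebraMap ℝ[X] (RatFunc ℝ) (c n) =
    ∏ j ∈ Finset.range n, pivot j ^ Fintype.card (G (n - 1 - j)).A := by
  have h0 : coupling 0 = 1 := by simp [coupling, num_zero, den_one]
  have h1 : coupling 1 = 1 := by simp [coupling, num_one, den_add_two, fac_zero, den_zero]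
  have h := interiorDet_eq_prod n 0 (-1) (-1) (by
    simp only [zero_add, h1, pivot, fac_one, fac_zero, den_one, map_sub, map_one, map_ofNat]
    ring)
  simp only [zero_add, h0, h1] at h
  rw [c_map, h]

theorem c_zero : c 0 = 1 :=
  RatFunc.algebraMap_injective ℝ (by rw [c_eq_prod_pivot, Finset.prod_range_zero, map_one])

theorem c_one : c 1 = fac 1 :=
  RatFunc.algebraMap_injective ℝ (by
    rw [c_eq_prod_pivot, Finset.prod_range_one, card_A_zero, pow_one, pivot, fac_zero, den_one,
      map_one, mul_one, div_one])

/-- By `card_A_add_two` the exponents of `pivot j` agree for `j < n`. For `j = n` they agree since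
`G 0` and `G 1` both have one `a`-edge, so only `pivot (n + 1)` is left over. -/
theorem c_add_two (n : ℕ) :
    c (n + 2) * (fac (n + 1) * den (n + 2)) = c n ^ 2 * c (n + 1) * fac (n + 2) := by
  apply RatFunc.algebraMap_injective ℝ
  have h : algebraMap ℝ[X] (RatFunc ℝ) (c (n + 2)) =
      algebraMap ℝ[X] (RatFunc ℝ) (c n) ^ 2 * algebraMap ℝ[X] (RatFunc ℝ) (c (n + 1)) *
        pivot (n + 1) := by
    simp only [c_eq_prod_pivot, Finset.prod_range_succ, ← Finset.prod_pow]
    simp only [Nat.add_sub_cancel, Nat.sub_self, card_A_zero, pow_one,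
      show n + 2 - 1 - n = 1 by omega, show n + 2 - 1 - (n + 1) = 0 by omega, card_A_one]
    rw [← mul_assoc, ← Finset.prod_mul_distrib]
    congr 2
    refine Finset.prod_congr rfl fun j hj => ?_
    have hj' := Finset.mem_range.1 hj
    obtain ⟨m, rfl⟩ : ∃ m, n = j + 1 + m := ⟨n - j - 1, by omega⟩
    rw [show j + 1 + m + 2 - 1 - j = m + 2 by omega, show j + 1 + m - 1 - j = m by omega,
      show j + 1 + m - j = m + 1 by omega, card_A_add_two]
    ring
  have h1 := algebraMap_fac_ne_zero (n + 1)
  have h2 := algebraMap_den_ne_zero (n + 2)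
  simp only [map_mul, map_pow]
  rw [h, pivot]
  field_simp

/-! ### Multiplicities of the factors -/

/-- The multiplicity of `γ_n` in `c_{n+m}`. -/
def facMult : ℕ → ℕ
  | 0 => 1
  | 1 => 0
  | m + 2 => 2 * facMult m + facMult (m + 1) - if m % 2 = 0 then 1 else 0

/-- This keeps the subtraction in `facMult` from truncating: 1 is subtracted only for even `m`, to
account for the factor in `den`. -/
theorem facMult_pos : ∀ m, m ≠ 1 → 1 ≤ facMult m
  | 0, _ => le_rfl
  | 1, h => absurd rfl h
  | 2, _ => le_rfl
  | 3, _ => le_rfl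
  | m + 4, _ => by
    have h := facMult_pos (m + 2) (by omega)
    rw [facMult]
    split_ifs <;> omega

theorem facMult_add_two (m : ℕ) :
    facMult (m + 2) + (if m % 2 = 0 then 1 else 0) = 2 * facMult m + facMult (m + 1) := by
  rw [facMult]
  split_ifs with h
  · have := facMult_pos m (by omega)
    omega
  · rfl

theorem den_eq_prod : ∀ n, den (n + 2) =
    ∏ k ∈ Finset.range (n + 1), fac k ^ (if (n - k) % 2 = 0 then 1 else 0)
  | 0 => by simp [den_add_two, den_zero]
  | 1 => by simp [den_add_two, den_one, Finset.prod_range_succ]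
  | n + 2 => by
    rw [den_add_two (n + 2), den_eq_prod n, Finset.prod_range_succ _ (n + 2),
      Finset.prod_range_succ _ (n + 1), mul_comm]
    have h1 : (n + 2 - (n + 1)) % 2 = 1 := by omega
    simp only [h1, Nat.sub_self, Nat.zero_mod, if_true, pow_one, one_ne_zero, if_false, pow_zero,
      mul_one]
    refine congrArg (· * _) (Finset.prod_congr rfl fun k hk => ?_)
    have hk' := Finset.mem_range.1 hk
    rw [show (n + 2 - k) % 2 = (n - k) % 2 by omega]

theorem c_eq_prod_fac (n : ℕ) :
    c n = ∏ k ∈ Finset.range (n + 1), fac k ^ facMult (n - k) := by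
  induction n using Nat.twoStepInduction with
  | zero => simp [c_zero, fac_zero]
  | one => simp [c_one, fac_zero, Finset.prod_range_succ, facMult]
  | more n ih0 ih1 =>
    have h := c_add_two n
    have hne : fac (n + 1) * den (n + 2) ≠ 0 :=
      mul_ne_zero (fac_monic _).ne_zero (den_monic _).ne_zero
    apply mul_right_cancel₀ hne
    rw [h, ih0, ih1, den_eq_prod, Finset.prod_range_succ _ (n + 2),
      Finset.prod_range_succ _ (n + 1), Finset.prod_range_succ _ (n + 1)]
    simp only [Nat.sub_self, show n + 2 - (n + 1) = 1 by omega, facMult, pow_one, pow_zero, mul_one]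
    have key : (∏ k ∈ Finset.range (n + 1), fac k ^ facMult (n - k)) ^ 2 *
        (∏ k ∈ Finset.range (n + 1), fac k ^ facMult (n + 1 - k)) =
        (∏ k ∈ Finset.range (n + 1), fac k ^ facMult (n + 2 - k)) *
        ∏ k ∈ Finset.range (n + 1), fac k ^ (if (n - k) % 2 = 0 then 1 else 0) := by
      rw [← Finset.prod_pow, ← Finset.prod_mul_distrib, ← Finset.prod_mul_distrib]
      refine Finset.prod_congr rfl fun k hk => ?_
      have hk' := Finset.mem_range.1 hk
      obtain ⟨m, rfl⟩ : ∃ m, n = k + m := ⟨n - k, by omega⟩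
      rw [show k + m + 2 - k = m + 2 by omega, show k + m + 1 - k = m + 1 by omega,
        Nat.add_sub_cancel_left, ← pow_mul, ← pow_add, ← pow_add, facMult_add_two]
      ring
    linear_combination (fac (n + 1) * fac (n + 2)) * key

theorem isFactorSequence_fac : IsFactorSequence fac := by
  refine ⟨fac_zero, fun n hn => ⟨fun k hk => isCoprime_fac (by omega),
    fun k => facMult (n - k), ?_⟩⟩
  rw [c_eq_prod_fac, Finset.prod_range_succ, Nat.sub_self, facMult, pow_one, mul_comm,
    Finset.range_eq_Ico, Finset.prod_eq_prod_Ico_succ_bot (by omega), fac_zero, one_pow, one_mul]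

/-! ### Uniqueness of the factor sequence -/

theorem IsFactorSequence.monic {γ : ℕ → ℝ[X]} (h : IsFactorSequence γ) (n : ℕ) :
    (γ n).Monic := by
  induction n using Nat.strong_induction_on with
  | _ n ih =>
    rcases Nat.eq_zero_or_pos n with rfl | hn
    · exact h.1 ▸ monic_one
    · obtain ⟨-, s, hs⟩ := h.2 n hn
      have hprod : (∏ k ∈ Finset.Ico 1 n, γ k ^ s k).Monic :=
        monic_prod_of_monic _ _ fun k hk => (ih k (Finset.mem_Ico.1 hk).2).pow _
      refine hprod.of_mul_monic_right ?_
      rw [← hs]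
      exact Matrix.charpoly_monic _

theorem IsFactorSequence.unique {γ γ' : ℕ → ℝ[X]} (h : IsFactorSequence γ)
    (h' : IsFactorSequence γ') : γ = γ' := by
  funext n
  induction n using Nat.strong_induction_on with
  | _ n ih =>
    rcases Nat.eq_zero_or_pos n with rfl | hn
    · rw [h.1, h'.1]
    · obtain ⟨hc, s, hs⟩ := h.2 n hn
      obtain ⟨hc', s', hs'⟩ := h'.2 n hn
      have hcop : IsCoprime (γ n) (∏ k ∈ Finset.Ico 1 n, γ' k ^ s' k) :=
        IsCoprime.prod_right fun k hk => by
          rw [← ih k (Finset.mem_Ico.1 hk).2]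
          exact (hc k (Finset.mem_Ico.1 hk).2).pow_right
      have hcop' : IsCoprime (γ' n) (∏ k ∈ Finset.Ico 1 n, γ k ^ s k) :=
        IsCoprime.prod_right fun k hk => by
          rw [ih k (Finset.mem_Ico.1 hk).2]
          exact (hc' k (Finset.mem_Ico.1 hk).2).pow_right
      exact eq_of_monic_of_associated (h.monic n) (h'.monic n) (associated_of_dvd_dvd
        (hcop.dvd_of_dvd_mul_right (hs' ▸ hs ▸ dvd_mul_right _ _))
        (hcop'.dvd_of_dvd_mul_right (hs ▸ hs' ▸ dvd_mul_right _ _)))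

/-! ### The degree of `eta` -/

theorem natDegree_eta_fac (n : ℕ) (hn : 1 ≤ n) :
    (eta fac n).natDegree + 2 ^ ((n - 1) / 2) = (fac n).natDegree := by
  have hsum : ∀ n, (eta fac n).natDegree = (fac (n - 1)).natDegree +
      ∑ j ∈ (Finset.range n).filter (fun j => 2 * j + 4 ≤ n),
        2 ^ j * (fac (n - 2 * j - 3)).natDegree := fun n => by
    rw [eta, (fac_monic _).natDegree_mul (monic_prod_of_monic _ _ fun j _ => (fac_monic _).pow _),
      natDegree_prod_of_monic _ _ fun j _ => (fac_monic _).pow _]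
    simp only [(fac_monic _).natDegree_pow]
  -- In the product for `n + 4` the factor `j = 0` is `fac (n + 1)`, and factor `j + 1` is the
  -- square of factor `j` for `n + 2`.
  have hstep : ∀ n, (eta fac (n + 4)).natDegree + (fac (n + 1)).natDegree =
      (fac (n + 3)).natDegree + 2 * (eta fac (n + 2)).natDegree := fun n => by
    have hset : (Finset.range (n + 4)).filter (fun j => 2 * j + 4 ≤ n + 4) =
        insert 0 (((Finset.range (n + 2)).filter (fun j => 2 * j + 4 ≤ n + 2)).map
          (addRightEmbedding 1)) := by
      ext j
      simp only [Finset.mem_filter, Finset.mem_range, Finset.mem_insert, Finset.mem_map,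
        addRightEmbedding_apply]
      constructor
      · rintro ⟨h1, h2⟩
        rcases j with _ | j
        · exact Or.inl rfl
        · exact Or.inr ⟨j, ⟨by omega, by omega⟩, rfl⟩
      · rintro (rfl | ⟨i, ⟨h1, h2⟩, rfl⟩) <;> constructor <;> omega
    rw [hsum, hsum, hset, Finset.sum_insert (by simp), Finset.sum_map]
    have hshift : ∀ j, n + 4 - 2 * (j + 1) - 3 = n + 2 - 2 * j - 3 := fun j => by omega
    simp only [addRightEmbedding_apply, hshift, pow_succ, mul_assoc, pow_zero]
    rw [mul_add, Finset.mul_sum]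
    simp only [mul_left_comm (2 ^ _) 2]
    simp only [show n + 4 - 1 = n + 3 by omega, show n + 2 - 1 = n + 1 by omega, mul_zero,
      show n + 4 - 0 - 3 = n + 1 by omega]
    ring
  have hrec := natDegree_fac_add_three
  induction n using Nat.strong_induction_on with
  | _ n ih =>
    rcases n with _ | _ | _ | _ | n
    · omega
    · rw [hsum]; simp [natDegree_fac_zero, natDegree_fac_one]
    · rw [hsum]; simp [natDegree_fac_one, natDegree_fac_two]
    · have h3 := hrec 0
      rw [hsum]
      simp [natDegree_fac_zero, natDegree_fac_one, natDegree_fac_two] at h3 ⊢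
      omega
    · have h1 := ih (n + 2) (by omega) (by omega)
      have h2 := hstep n
      have h3 := hrec (n + 1)
      rw [show n + 1 + 3 = n + 4 by omega, show n + 1 + 2 = n + 3 by omega,
        show n + 1 + 1 = n + 2 by omega] at h3
      rw [show (n + 2 - 1) / 2 = (n + 1) / 2 by omega] at h1
      change (eta fac (n + 4)).natDegree + 2 ^ ((n + 4 - 1) / 2) = (fac (n + 4)).natDegree
      rw [show (n + 4 - 1) / 2 = (n + 1) / 2 + 1 by omega, pow_succ]
      omega

/-! ### Trigonometric closed form -/

/-- The three cosines are the roots of `4x^3 - 3x = cos 3φ = √7 / 14`, which gives the symmetric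
functions. The last, cyclic sum is not symmetric and also needs `sin 3φ`. Writing `cos(φ + π/3) =
-d` gives `rho₃` the same shape as `rho₁` and `rho₂`. -/
theorem exists_roots_trig :
    ∃ a b d : ℝ, Real.cos phi = a ∧ Real.cos (phi + 2 * Real.pi / 3) = b ∧
      Real.cos (phi + 4 * Real.pi / 3) = d ∧ Real.cos (phi + Real.pi / 3) = -d ∧
      a + b + d = 0 ∧ a * b + b * d + d * a = -(3 / 4) ∧ a * b * d = √7 / 56 ∧
      a ^ 2 * b + b ^ 2 * d + d ^ 2 * a = 3 * √7 / 14 := by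
  have h3 : √3 ^ 2 = 3 := Real.sq_sqrt (by norm_num)
  have h7 : √7 ^ 2 = 7 := Real.sq_sqrt (by norm_num)
  have h7' : (0 : ℝ) < √7 := by positivity
  have hphi : 3 * phi = Real.arctan (-3 * √3) := by rw [phi]; ring
  have hroot : √(1 + (-3 * √3) ^ 2) = 2 * √7 := by
    rw [mul_pow, h3, show (1 + (-3) ^ 2 * 3 : ℝ) = 2 ^ 2 * 7 by norm_num, Real.sqrt_mul (by norm_num),
      Real.sqrt_sq (by norm_num)]
  have hcos : 4 * Real.cos phi ^ 3 - 3 * Real.cos phi = √7 / 14 := by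
    rw [← Real.cos_three_mul, hphi, Real.cos_arctan, hroot]
    field_simp
    linarith
  have hsin : 3 * Real.sin phi - 4 * Real.sin phi ^ 3 = -3 * √3 * √7 / 14 := by
    rw [← Real.sin_three_mul, hphi, Real.sin_arctan, hroot]
    field_simp
    linarith
  have hc3 : Real.cos (Real.pi / 3) = 1 / 2 := Real.cos_pi_div_three
  have hs3 : Real.sin (Real.pi / 3) = √3 / 2 := Real.sin_pi_div_three
  have e1 : Real.cos (phi + 2 * Real.pi / 3) = -(Real.cos phi / 2) - √3 / 2 * Real.sin phi := by
    rw [show phi + 2 * Real.pi / 3 = phi - Real.pi / 3 + Real.pi by ring, Real.cos_add_pi,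
      Real.cos_sub, hc3, hs3]
    ring
  have e3 : Real.cos (phi + Real.pi / 3) = -(-(Real.cos phi / 2) + √3 / 2 * Real.sin phi) := by
    rw [Real.cos_add, hc3, hs3]
    ring
  have e2 : Real.cos (phi + 4 * Real.pi / 3) = -(Real.cos phi / 2) + √3 / 2 * Real.sin phi := by
    rw [show phi + 4 * Real.pi / 3 = phi + Real.pi / 3 + Real.pi by ring, Real.cos_add_pi, e3]
    ring
  have hcs := Real.sin_sq_add_cos_sq phi
  refine ⟨_, _, _, rfl, e1, e2, e3, ?_⟩
  generalize Real.cos phi = x at *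
  generalize Real.sin phi = y at *
  refine ⟨by ring, ?_, ?_, ?_⟩
  · linear_combination (-(3 / 4)) * hcs - y ^ 2 / 4 * h3
  · linear_combination (1 / 4) * hcos - x * y ^ 2 / 4 * h3 - 3 / 4 * x * hcs
  · linear_combination (-3 / 8) * hcos - 3 / 8 * √3 * hsin + (9 / 8 * x - 9 / 8 * √3 * y) * hcs +
      (√3 * y ^ 3 / 8 + 3 / 8 * x * y ^ 2 + 9 / 112 * √7) * h3

theorem roots_factor :
    (X ^ 3 - X ^ 2 - 2 * X + 1 : ℝ[X]) = (X - C rho₁) * (X - C rho₂) * (X - C rho₃) := by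
  obtain ⟨a, b, d, ha, hb, -, hd, h1, h2, h3, -⟩ := exists_roots_trig
  have h7 : √7 ^ 2 = 7 := Real.sq_sqrt (by norm_num)
  have s1 : rho₁ + rho₂ + rho₃ = 1 := by
    rw [rho₁, rho₂, rho₃, ha, hb, hd]
    linear_combination (-2 / 3 * √7) * h1
  have s2 : rho₁ * rho₂ + rho₂ * rho₃ + rho₃ * rho₁ = -2 := by
    rw [rho₁, rho₂, rho₃, ha, hb, hd]
    linear_combination (-4 / 9 * √7) * h1 + 4 / 9 * √7 ^ 2 * h2 - 1 / 3 * h7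
  have s3 : rho₁ * rho₂ * rho₃ = -1 := by
    rw [rho₁, rho₂, rho₃, ha, hb, hd]
    linear_combination (-2 / 27 * √7) * h1 + 4 / 27 * √7 ^ 2 * h2 - 8 / 27 * √7 ^ 3 * h3 -
      (1 / 9 + 1 / 189 * (√7 ^ 2 + 7)) * h7
  have p1 := congrArg C s1
  have p2 := congrArg C s2
  have p3 := congrArg C s3
  simp only [map_add, map_mul, map_neg, map_one, map_ofNat] at p1 p2 p3
  linear_combination (X ^ 2) * p1 - X * p2 + p3

/-- Each root is built from one cosine and weighted by the next in cyclic order, so the value at 2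
is where the cyclic sum enters. -/
theorem closed_form (u : ℕ → ℝ) (h0 : u 0 = 0) (h1 : u 1 = 1) (h2 : u 2 = 2)
    (hrec : ∀ n, u (n + 3) = u (n + 2) + 2 * u (n + 1) - u n) (n : ℕ) :
    u n = 2 / √7 * (rho₁ ^ n * Real.cos (phi + 2 * Real.pi / 3) +
      rho₂ ^ n * Real.cos (phi + 4 * Real.pi / 3) + rho₃ ^ n * Real.cos phi) := by
  have hroot : ∀ r, (r - rho₁) * (r - rho₂) * (r - rho₃) = 0 → r ^ 3 = r ^ 2 + 2 * r - 1 := by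
    intro r hr
    have h := congrArg (eval r) roots_factor
    simp only [eval_add, eval_sub, eval_mul, eval_pow, eval_X, eval_C, eval_one, eval_ofNat] at h
    linear_combination h + hr
  have r1 := hroot rho₁ (by ring)
  have r2 := hroot rho₂ (by ring)
  have r3 := hroot rho₃ (by ring)
  obtain ⟨a, b, d, ha, hb, hd, hd', e1, e2, -, e3⟩ := exists_roots_trig
  have h7 : √7 ^ 2 = 7 := Real.sq_sqrt (by norm_num)
  have h7' : √7 ≠ 0 := by positivity
  have main : ∀ n,
      u n = 2 / √7 * (rho₁ ^ n * b + rho₂ ^ n * d + rho₃ ^ n * a) ∧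
      u (n + 1) = 2 / √7 * (rho₁ ^ (n + 1) * b + rho₂ ^ (n + 1) * d + rho₃ ^ (n + 1) * a) ∧
      u (n + 2) = 2 / √7 * (rho₁ ^ (n + 2) * b + rho₂ ^ (n + 2) * d + rho₃ ^ (n + 2) * a) := by
    intro n
    induction n with
    | zero =>
      simp only [zero_add, h0, h1, h2, rho₁, rho₂, rho₃, ha, hb, hd']
      refine ⟨?_, ?_, ?_⟩
      · linear_combination (-2 / √7) * e1
      · field_simp
        linear_combination (-2) * e1 + 4 * √7 * e2
      · field_simp
        linear_combination -e1 + 4 * √7 * e2 - 4 * √7 ^ 2 * e3 - 6 / 7 * √7 * h7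
    | succ n ih =>
      obtain ⟨i0, i1, i2⟩ := ih
      refine ⟨i1, i2, ?_⟩
      change u (n + 3) = _
      rw [hrec, i0, i1, i2]
      linear_combination (-2 / √7) * (rho₁ ^ n * b * r1 + rho₂ ^ n * d * r2 + rho₃ ^ n * a * r3)
  rw [ha, hb, hd]
  exact (main n).1

end Basilica

theorem mainTheorem9 :
    -- the factors are well defined
    (∃! γ : ℕ → Polynomial ℝ, Basilica.IsFactorSequence γ) ∧
    -- the numbers `ρ_j` are the roots of `ρ^3 - ρ^2 - 2ρ + 1`
    ((Polynomial.X ^ 3 - Polynomial.X ^ 2 - 2 * Polynomial.X + 1 : Polynomial ℝ) =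
      (Polynomial.X - Polynomial.C Basilica.rho₁) * (Polynomial.X - Polynomial.C Basilica.rho₂) *
        (Polynomial.X - Polynomial.C Basilica.rho₃)) ∧
    ∀ γ : ℕ → Polynomial ℝ, Basilica.IsFactorSequence γ →
      -- the closed form of the degrees
      (∀ n : ℕ, ((γ n).natDegree : ℝ) =
        2 / √7 * (Basilica.rho₁ ^ n * Real.cos (Basilica.phi + 2 * Real.pi / 3) +
          Basilica.rho₂ ^ n * Real.cos (Basilica.phi + 4 * Real.pi / 3) +
          Basilica.rho₃ ^ n * Real.cos Basilica.phi)) ∧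
      -- the recursion for the degrees, with its initial values
      ((γ 0).natDegree = 0 ∧ (γ 1).natDegree = 1 ∧ (γ 2).natDegree = 2 ∧
        ∀ n : ℕ, 3 ≤ n → ((γ n).natDegree : ℤ) =
          (γ (n - 1)).natDegree + 2 * (γ (n - 2)).natDegree - (γ (n - 3)).natDegree) ∧
      -- for `n ≥ 1` the number `(n - 1) / 2`, rounded down, is the greatest integer less than `n/2`
      (∀ n : ℕ, 1 ≤ n →
        ((Basilica.eta γ n).natDegree : ℤ) = (γ n).natDegree - 2 ^ ((n - 1) / 2)) := by
  refine ⟨⟨Basilica.fac, Basilica.isFactorSequence_fac, fun γ h =>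
    h.unique Basilica.isFactorSequence_fac⟩, Basilica.roots_factor, fun γ h => ?_⟩
  obtain rfl := h.unique Basilica.isFactorSequence_fac
  have hrec := Basilica.natDegree_fac_add_three
  refine ⟨?_, ⟨Basilica.natDegree_fac_zero, Basilica.natDegree_fac_one,
    Basilica.natDegree_fac_two, fun n hn => ?_⟩, fun n hn => ?_⟩
  · refine Basilica.closed_form (fun n => ((Basilica.fac n).natDegree : ℝ)) ?_ ?_ ?_ fun n => ?_
    · simp [Basilica.natDegree_fac_zero]
    · simp [Basilica.natDegree_fac_one]
    · simp [Basilica.natDegree_fac_two]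
    · rw [eq_sub_iff_add_eq]
      exact_mod_cast hrec n
  · obtain ⟨m, rfl⟩ := Nat.exists_eq_add_of_le' hn
    rw [eq_sub_iff_add_eq]
    exact_mod_cast hrec m
  · rw [eq_sub_iff_add_eq]
    exact_mod_cast Basilica.natDegree_eta_fac n hn
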